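/- Fix an integer $s\ge 3$ and a real $\epsilon>0$. For each $K\in\mathbb N$ let $n=Ks$, let $p=p_K\in(\epsilon,1]$ and $r=r_K\in[0,1]$, with $r=O(n^{-1})$ as $K\to\infty$. Let $A=A_K$ be the adjacency matrix of a random simple graph on $n$ nodes drawn from the four-parameter Stochastic Blockmodel: the nodes carry (deterministic or random) labels that partition them into $K$ blocks with exactly $s$ nodes each, and, conditionally on the labels, the edges are independent, an edge between two nodes being present with probability $p$ if they lie in the same block and $r$ if they lie in different blocks. Let $$\mathrm{trans}(A)=\frac{\text{number of closed triplets in }A}{\text{number of connected triples of vertices in }A}=\frac{6\cdot\#\{\text{triangles}\}}{2\cdot\#\{\text{two-stars}\}}$$ (with value $0$ if there are no connected triples). For $\rho \ge 0$ and $0<p\le 1$ put $$c_s(p,\rho)=\frac{(s-1)(s-2)\,p^3}{(s-1)(s-2)\,p^2+2(s-1)\,p\,\rho+\rho^2}.$$ Then, as $K\to\infty$ (so $n\to\infty$): 1. the numbers $c_s(p_K,n\,r_K)$ are bounded below by a positive constant, uniformly in $K$; 2. $\mathrm{trans}(A_K)-c_s(p_K,n\,r_K)\to 0$ in probability; 3.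 if moreover $p_K\to p'$ and $n\,r_K\to\rho$ (in particular if $p$ is fixed and $r=\rho/n$), then $\mathrm{trans}(A_K)\to c_s(p',\rho)$ in probability, and $c_s(p',\rho)>0$. -/

import Mathlib

open MeasureTheory Filter Topology Asymptotics

/-- The number of closed triplets of a graph: ordered triples `(i, j, k)` of vertices with
`i ~ j`, `j ~ k` and `k ~ i`. This is six times the number of triangles, `trace (A * A * A)`. -/
noncomputable def closedTriplets {V : Type*} [Fintype V] (G : SimpleGraph V) : ℕ :=
  open Classical in
  (Finset.univ.filter fun t : V × V × V =>
    G.Adj t.1 t.2.1 ∧ G.Adj t.2.1 t.2.2 ∧ G.Adj t.2.2 t.1).card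

/-- The number of connected triples of vertices of a graph: ordered triples `(i, j, k)` of
vertices with `i ~ j`, `j ~ k` and `i ≠ k`. This is twice the number of two-stars,
`∑ j, (d j ^ 2 - d j)`. -/
noncomputable def connectedTriples {V : Type*} [Fintype V] (G : SimpleGraph V) : ℕ :=
  open Classical in
  (Finset.univ.filter fun t : V × V × V =>
    G.Adj t.1 t.2.1 ∧ G.Adj t.2.1 t.2.2 ∧ t.1 ≠ t.2.2).card

/-- The transitivity ratio of a graph (with value `0` if there are no connected triples). -/
noncomputable def transitivityRatio {V : Type*} [Fintype V] (G : SimpleGraph V) : ℝ :=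
  (closedTriplets G : ℝ) / (connectedTriples G : ℝ)

/-- The random graph `G` on the vertices `Fin n` (equivalently its adjacency matrix: symmetric,
binary, with zero diagonal) follows the Stochastic Blockmodel with random block labels `ξ` and
edge probabilities `Θ`: conditionally on the labels, the edges `{i, j}`, `i < j`, are independent
and `{i, j}` is present with probability `Θ (ξ i) (ξ j)`. The law of the labels is arbitrary; in
particular they may be deterministic. -/
structure IsStochasticBlockmodel {Ω : Type*} [MeasurableSpace Ω] (P : Measure Ω) {n K : ℕ}
    (Θ : Matrix (Fin K) (Fin K) ℝ) (ξ : Ω → Fin n → Fin K) (G : Ω → SimpleGraph (Fin n)) :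
    Prop where
  prob_mem : ∀ a b, Θ a b ∈ Set.Icc (0 : ℝ) 1
  measurableSet_label : ∀ z, MeasurableSet {ω | ξ ω = z}
  measurableSet_graph : ∀ g, MeasurableSet {ω | G ω = g}
  law : open Classical in ∀ (z : Fin n → Fin K) (g : SimpleGraph (Fin n)),
    P.real {ω | ξ ω = z ∧ G ω = g} =
      P.real {ω | ξ ω = z} *
        ∏ i : Fin n, ∏ j ∈ Finset.Ioi i,
          if g.Adj i j then Θ (z i) (z j) else 1 - Θ (z i) (z j)

/-- The four parameter Stochastic Blockmodel: `K` blocks, exactly `s` nodes in each block (so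
there are `n = K * s` nodes), in-block probability `p`, out-of-block probability `r`. -/
structure IsFourParameterSBM {Ω : Type*} [MeasurableSpace Ω] (P : Measure Ω) (K s : ℕ) (p r : ℝ)
    (ξ : Ω → Fin (K * s) → Fin K) (G : Ω → SimpleGraph (Fin (K * s))) : Prop where
  p_mem : p ∈ Set.Icc (0 : ℝ) 1
  r_mem : r ∈ Set.Icc (0 : ℝ) 1
  blocks : ∀ᵐ ω ∂P, ∀ a : Fin K, (Finset.univ.filter fun i => ξ ω i = a).card = s
  sbm : IsStochasticBlockmodel P (Matrix.of fun a b : Fin K => if a = b then p else r) ξ G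

/-- The limiting transitivity ratio for block size `s`, in-block probability `p` and
out-of-block probability `ρ / n`. -/
noncomputable def limitTransitivity (s : ℕ) (p ρ : ℝ) : ℝ :=
  (((s : ℝ) - 1) * ((s : ℝ) - 2) * p ^ 3) /
    (((s : ℝ) - 1) * ((s : ℝ) - 2) * p ^ 2 + 2 * ((s : ℝ) - 1) * p * ρ + ρ ^ 2)

/-- Convergence in probability to a constant of random variables `X K`, which may be defined on
different probability spaces. -/
def TendstoInProbability {Ω : ℕ → Type*} [∀ K, MeasurableSpace (Ω K)]
    (P : ∀ K, Measure (Ω K)) (X : ∀ K, Ω K → ℝ) (c : ℝ) : Prop :=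
  ∀ δ : ℝ, 0 < δ → Tendsto (fun K => P K {ω | δ ≤ |X K ω - c|}) atTop (𝓝 0)

/-! Condition on balanced labels: the edges are then independent. Write `t`, `c` for the numerator
and denominator of `limitTransitivity`, and let `n * r ≤ M`. A triangle not inside one block has at
least two between-block edges, so such triangles contribute `O(1)` to the expected count, and closed
triplets have mean `n * t + O(1)`. Counting paths by their middle vertex, whose mean degree is `(s -
1) * p + (n - s) * r`, gives connected triples mean `n * c + O(1)`.

Both variances are `O(n)` by Efron–Stein (`bernoulliExpect_sq_le_efronStein`): adding the edge `ab`
raises either count by at most `6 * (deg a + deg b)`, degrees have bounded second moment, and the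
expected number of edges is `O(n)`. These facts combine in `exists_second_moment_le`.

Chebyshev puts both counts within `η * n` of their targets up to probability `O(1 / n)`. Since `c ≥
2 * ε ^ 2`, the ratio is then close to `t / c` (`abs_div_sub_div_lt`). The constants do not depend
on the labelling, so `IsFourParameterSBM.measureReal_le` averages over it. -/

/-- The expectation of `f S`, where `S` is the random subset of `s` that contains each `e ∈ s`
independently with probability `q e`. -/
noncomputable def bernoulliExpect {α : Type*} [DecidableEq α] (q : α → ℝ) (s : Finset α)
    (f : Finset α → ℝ) : ℝ :=
  ∑ S ∈ s.powerset, (∏ e ∈ S, q e) * (∏ e ∈ s \ S, (1 - q e)) * f S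

/-! ### Independent Bernoulli variables and the Efron–Stein inequality -/

section BernoulliExpect

variable {α : Type*} [DecidableEq α] {q : α → ℝ} {s : Finset α} {f g : Finset α → ℝ}

theorem bernoulliExpect_congr (h : ∀ S ⊆ s, f S = g S) :
    bernoulliExpect q s f = bernoulliExpect q s g :=
  Finset.sum_congr rfl fun S hS => by rw [h S (Finset.mem_powerset.1 hS)]

theorem bernoulliExpect_mono (hq : ∀ e, q e ∈ Set.Icc (0 : ℝ) 1) (h : ∀ S ⊆ s, f S ≤ g S) :
    bernoulliExpect q s f ≤ bernoulliExpect q s g :=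
  Finset.sum_le_sum fun S hS => mul_le_mul_of_nonneg_left (h S (Finset.mem_powerset.1 hS))
    (mul_nonneg (Finset.prod_nonneg fun e _ => (hq e).1)
      (Finset.prod_nonneg fun e _ => sub_nonneg.2 (hq e).2))

theorem bernoulliExpect_add :
    bernoulliExpect q s (fun S => f S + g S) = bernoulliExpect q s f + bernoulliExpect q s g := by
  simp only [bernoulliExpect, mul_add, Finset.sum_add_distrib]

theorem bernoulliExpect_const_mul (c : ℝ) :
    bernoulliExpect q s (fun S => c * f S) = c * bernoulliExpect q s f := by
  simp only [bernoulliExpect, Finset.mul_sum]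
  exact Finset.sum_congr rfl fun S _ => by ring

theorem bernoulliExpect_sum {ι : Type*} (I : Finset ι) (F : ι → Finset α → ℝ) :
    bernoulliExpect q s (fun S => ∑ i ∈ I, F i S) = ∑ i ∈ I, bernoulliExpect q s (F i) := by
  simp only [bernoulliExpect, Finset.mul_sum]
  exact Finset.sum_comm

theorem bernoulliExpect_subset {A : Finset α} (hA : A ⊆ s) :
    bernoulliExpect q s (fun S => if A ⊆ S then 1 else 0) = ∏ e ∈ A, q e := by
  -- Replacing the weight `1 - q e` by `0` on `A` kills exactly the subsets that miss an element of
  -- `A`; the expanded product is then the wanted sum.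
  have h := Finset.prod_add (s := s) q (fun e => if e ∈ A then 0 else 1 - q e)
  have h1 : ∏ e ∈ s, (q e + if e ∈ A then 0 else 1 - q e) = ∏ e ∈ A, q e := by
    rw [← Finset.prod_subset hA]
    · exact Finset.prod_congr rfl fun e he => by simp [he]
    · intro e _ he
      simp [he]
  rw [← h1, h, bernoulliExpect]
  refine Finset.sum_congr rfl fun S _ => ?_
  by_cases hAS : A ⊆ S
  · rw [if_pos hAS, mul_one]
    congr 1
    refine Finset.prod_congr rfl fun e he => ?_
    rw [if_neg fun h => (Finset.mem_sdiff.1 he).2 (hAS h)]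
  · rw [if_neg hAS, mul_zero]
    obtain ⟨e, he, heS⟩ := Finset.not_subset.1 hAS
    rw [Finset.prod_eq_zero (Finset.mem_sdiff.2 ⟨hA he, heS⟩) (by simp [he]), mul_zero]

theorem bernoulliExpect_const (c : ℝ) : bernoulliExpect q s (fun _ => c) = c := by
  have h := bernoulliExpect_const_mul (q := q) (s := s)
    (f := fun S => if (∅ : Finset α) ⊆ S then 1 else 0) c
  rw [bernoulliExpect_subset (Finset.empty_subset s)] at h
  simpa using h

theorem bernoulliExpect_sub_sq (m : ℝ) :
    bernoulliExpect q s (fun S => (f S - m) ^ 2) =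
      bernoulliExpect q s (fun S => f S ^ 2) - 2 * m * bernoulliExpect q s f + m ^ 2 := by
  rw [← bernoulliExpect_const (q := q) (s := s) (m ^ 2), sub_eq_add_neg, ← neg_mul,
    ← bernoulliExpect_const_mul, ← bernoulliExpect_add, ← bernoulliExpect_add]
  congr 1
  funext S
  ring

theorem sq_bernoulliExpect_le (hq : ∀ e, q e ∈ Set.Icc (0 : ℝ) 1) :
    bernoulliExpect q s f ^ 2 ≤ bernoulliExpect q s (fun S => f S ^ 2) := by
  have h := bernoulliExpect_mono (q := q) (s := s) (f := fun _ => 0)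
    (g := fun S => (f S - bernoulliExpect q s f) ^ 2) hq fun S _ => sq_nonneg _
  rw [bernoulliExpect_const, bernoulliExpect_sub_sq] at h
  linarith

/-- Conditioning on whether `a` is chosen; this drives the induction in Efron–Stein. -/
theorem bernoulliExpect_insert {a : α} (ha : a ∉ s) :
    bernoulliExpect q (insert a s) f =
      (1 - q a) * bernoulliExpect q s f + q a * bernoulliExpect q s (fun S => f (insert a S)) := by
  simp only [bernoulliExpect]
  rw [Finset.sum_powerset_insert ha, Finset.mul_sum, Finset.mul_sum]
  congr 1
  · refine Finset.sum_congr rfl fun S hS => ?_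
    have haS : a ∉ S := fun h => ha (Finset.mem_powerset.1 hS h)
    rw [Finset.insert_sdiff_of_notMem _ haS, Finset.prod_insert (by simp [ha])]
    ring
  · refine Finset.sum_congr rfl fun S hS => ?_
    have haS : a ∉ S := fun h => ha (Finset.mem_powerset.1 hS h)
    rw [Finset.prod_insert haS, Finset.insert_sdiff_insert, Finset.sdiff_insert_of_notMem ha]
    ring

/-- The Efron–Stein inequality for functions of independent Bernoulli variables. -/
theorem bernoulliExpect_sq_le_efronStein (hq : ∀ e, q e ∈ Set.Icc (0 : ℝ) 1) :
    bernoulliExpect q s (fun S => f S ^ 2) ≤ bernoulliExpect q s f ^ 2 +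
      ∑ e ∈ s, q e * bernoulliExpect q s (fun S => (f (insert e S) - f (S.erase e)) ^ 2) := by
  induction s using Finset.induction_on generalizing f with
  | empty => simp [bernoulliExpect]
  | insert a s ha ih =>
    have h0 := ih (f := f)
    have h1 := ih (f := fun S => f (insert a S))
    have hD : bernoulliExpect q (insert a s) (fun S => (f (insert a S) - f (S.erase a)) ^ 2) =
        bernoulliExpect q s (fun S => (f (insert a S) - f S) ^ 2) := by
      rw [bernoulliExpect_insert ha]
      have e1 : bernoulliExpect q s (fun S => (f (insert a S) - f (S.erase a)) ^ 2) =
          bernoulliExpect q s (fun S => (f (insert a S) - f S) ^ 2) :=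
        bernoulliExpect_congr fun S hS => by
          rw [Finset.erase_eq_of_notMem fun h => ha (hS h)]
      have e2 : bernoulliExpect q s (fun S => (f (insert a (insert a S)) -
          f ((insert a S).erase a)) ^ 2) =
          bernoulliExpect q s (fun S => (f (insert a S) - f S) ^ 2) :=
        bernoulliExpect_congr fun S hS => by
          rw [Finset.erase_insert fun h => ha (hS h), Finset.insert_idem]
      rw [e1, e2]
      ring
    have hJ := sq_bernoulliExpect_le (s := s) (f := fun S => f (insert a S) - f S) hq
    have hS : bernoulliExpect q s (fun S => f (insert a S) - f S) =
        bernoulliExpect q s (fun S => f (insert a S)) - bernoulliExpect q s f := by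
      simp only [bernoulliExpect, mul_sub, Finset.sum_sub_distrib]
    rw [hS] at hJ
    have hsum : ∑ e ∈ s, q e * bernoulliExpect q (insert a s)
          (fun S => (f (insert e S) - f (S.erase e)) ^ 2) =
        (1 - q a) * ∑ e ∈ s, q e * bernoulliExpect q s
          (fun S => (f (insert e S) - f (S.erase e)) ^ 2) +
        q a * ∑ e ∈ s, q e * bernoulliExpect q s
          (fun S => (f (insert a (insert e S)) - f (insert a (S.erase e))) ^ 2) := by
      rw [Finset.mul_sum, Finset.mul_sum, ← Finset.sum_add_distrib]
      refine Finset.sum_congr rfl fun e he => ?_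
      have hea : a ≠ e := fun h => ha (h ▸ he)
      rw [bernoulliExpect_insert ha]
      simp only [Finset.insert_comm e a, Finset.erase_insert_of_ne hea]
      ring
    rw [Finset.sum_insert ha, hsum, hD, bernoulliExpect_insert ha, bernoulliExpect_insert ha]
    set x := bernoulliExpect q s f
    set y := bernoulliExpect q s (fun S => f (insert a S))
    have hqa := hq a
    have i0 := mul_le_mul_of_nonneg_left h0 (sub_nonneg.2 hqa.2)
    have i1 := mul_le_mul_of_nonneg_left h1 hqa.1
    have i2 := mul_le_mul_of_nonneg_left hJ hqa.1
    -- The two branch means `x`, `y` contribute variance `q a * (1 - q a) * (y - x) ^ 2`; dropping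
    -- the term `i3` leaves the weight `q a`, and `hJ` bounds `(y - x) ^ 2`.
    have i3 : 0 ≤ q a ^ 2 * (y - x) ^ 2 := by positivity
    nlinarith

/-- A bound on the second moment about an arbitrary point. -/
theorem bernoulliExpect_sub_sq_le (hq : ∀ e, q e ∈ Set.Icc (0 : ℝ) 1) (m : ℝ) :
    bernoulliExpect q s (fun S => (f S - m) ^ 2) ≤ (bernoulliExpect q s f - m) ^ 2 +
      ∑ e ∈ s, q e * bernoulliExpect q s (fun S => (f (insert e S) - f (S.erase e)) ^ 2) := by
  have h := bernoulliExpect_sq_le_efronStein (s := s) (f := f) hq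
  rw [bernoulliExpect_sub_sq]
  linarith

end BernoulliExpect

/-! ### Triple counts and the effect of adding one edge -/

section TripleCounts

variable {V : Type*}

open Classical in
/-- The indicator of adjacency: the entries of the adjacency matrix. -/
noncomputable def adjIndicator (G : SimpleGraph V) (i j : V) : ℝ := if G.Adj i j then 1 else 0

theorem adjIndicator_self (G : SimpleGraph V) (i : V) : adjIndicator G i i = 0 := by
  simp [adjIndicator]

theorem adjIndicator_comm (G : SimpleGraph V) (i j : V) :
    adjIndicator G i j = adjIndicator G j i := by
  by_cases h : G.Adj i j
  · simp [adjIndicator, h, h.symm]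
  · simp [adjIndicator, h, mt G.adj_symm h]

theorem adjIndicator_mul_self (G : SimpleGraph V) (i j : V) :
    adjIndicator G i j * adjIndicator G i j = adjIndicator G i j := by
  simp [adjIndicator]

variable [Fintype V]

theorem closedTriplets_eq_sum (G : SimpleGraph V) :
    (closedTriplets G : ℝ) =
      ∑ i, ∑ j, ∑ k, adjIndicator G i j * adjIndicator G j k * adjIndicator G k i := by
  classical
  simp only [closedTriplets, Finset.card_filter, Nat.cast_sum, Fintype.sum_prod_type, adjIndicator]
  refine Finset.sum_congr rfl fun i _ => Finset.sum_congr rfl fun j _ =>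
    Finset.sum_congr rfl fun k _ => ?_
  by_cases h1 : G.Adj i j <;> by_cases h2 : G.Adj j k <;> by_cases h3 : G.Adj k i <;>
    simp [h1, h2, h3]

theorem connectedTriples_eq_sum [DecidableEq V] (G : SimpleGraph V) :
    (connectedTriples G : ℝ) =
      ∑ i, ∑ j, ∑ k, if i = k then 0 else adjIndicator G i j * adjIndicator G j k := by
  simp only [connectedTriples, Finset.card_filter, Nat.cast_sum, Fintype.sum_prod_type,
    adjIndicator]
  refine Finset.sum_congr rfl fun i _ => Finset.sum_congr rfl fun j _ =>
    Finset.sum_congr rfl fun k _ => ?_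
  by_cases h1 : G.Adj i j <;> by_cases h2 : G.Adj j k <;> by_cases h3 : i = k <;>
    simp [h1, h2, h3]

theorem closedTriplets_mono {G H : SimpleGraph V} (h : G ≤ H) :
    closedTriplets G ≤ closedTriplets H := by
  classical
  exact Finset.card_le_card (Finset.monotone_filter_right _ fun t _ ht =>
    ⟨h ht.1, h ht.2.1, h ht.2.2⟩)

theorem connectedTriples_mono {G H : SimpleGraph V} (h : G ≤ H) :
    connectedTriples G ≤ connectedTriples H := by
  classical
  exact Finset.card_le_card (Finset.monotone_filter_right _ fun t _ ht =>
    ⟨h ht.1, h ht.2.1, ht.2.2⟩)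

/-- The number of neighbours, as a real number. -/
noncomputable def adjDegree (G : SimpleGraph V) (i : V) : ℝ := ∑ j, adjIndicator G i j

open Classical in
theorem adjDegree_eq_card (G : SimpleGraph V) (i : V) :
    adjDegree G i = ((Finset.univ.filter fun j => G.Adj i j).card : ℝ) := by
  simp [adjDegree, adjIndicator]

/-- A new closed triplet uses the edge `ab`, in one of six ordered positions, and its third vertex
is a neighbour of `a` already in `G₀`. Degrees are taken in a larger `G` so that the bound does not
depend on whether `ab` was present. -/
theorem closedTriplets_le_of_add_edge {G G₀ G₁ : SimpleGraph V} {a b : V} (h₀ : G₀ ≤ G)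
    (h₁ : ∀ i j, G₁.Adj i j → G₀.Adj i j ∨ (i = a ∧ j = b) ∨ (i = b ∧ j = a)) :
    (closedTriplets G₁ : ℝ) ≤ closedTriplets G₀ + 6 * (adjDegree G a + adjDegree G b) := by
  classical
  rw [adjDegree_eq_card, adjDegree_eq_card]
  set N := Finset.univ.filter fun j => G.Adj a j
  set M := Finset.univ.filter fun j => G.Adj b j
  have key : closedTriplets G₁ ≤ closedTriplets G₀ + (N.card + N.card + N.card + N.card +
      N.card + N.card) := by
    unfold closedTriplets
    refine (Finset.card_le_card (t := (Finset.univ.filter fun t : V × V × V =>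
      G₀.Adj t.1 t.2.1 ∧ G₀.Adj t.2.1 t.2.2 ∧ G₀.Adj t.2.2 t.1) ∪
      (N.image (fun k => (a, b, k)) ∪ N.image (fun k => (b, a, k)) ∪
        N.image (fun k => (k, a, b)) ∪ N.image (fun k => (k, b, a)) ∪
        N.image (fun k => (a, k, b)) ∪ N.image (fun k => (b, k, a)))) ?_).trans ?_
    · rintro ⟨i, j, k⟩ ht
      simp only [Finset.mem_filter, Finset.mem_univ, true_and, Finset.mem_union, Finset.mem_image,
        Prod.mk.injEq, N] at ht ⊢
      obtain ⟨x1, x2, x3⟩ := ht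
      have n1 := x1.ne
      have n2 := x2.ne
      have n3 := x3.ne
      have g := fun u v (h : G₀.Adj u v) => h₀ h
      have y1 := h₁ _ _ x1
      have y2 := h₁ _ _ x2
      have y3 := h₁ _ _ x3
      have gs := fun u v (h : G.Adj u v) => h.symm
      grind
    · exact (Finset.card_union_le _ _).trans (Nat.add_le_add_left
        ((Finset.card_union_le _ _).trans (add_le_add ((Finset.card_union_le _ _).trans
        (add_le_add ((Finset.card_union_le _ _).trans (add_le_add ((Finset.card_union_le _ _).trans
        (add_le_add ((Finset.card_union_le _ _).trans (add_le_add Finset.card_image_le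
        Finset.card_image_le)) Finset.card_image_le)) Finset.card_image_le))
        Finset.card_image_le)) Finset.card_image_le)) _)
  have key' : (closedTriplets G₁ : ℝ) ≤ closedTriplets G₀ + (N.card + N.card + N.card + N.card +
      N.card + N.card) := by exact_mod_cast key
  have := Nat.cast_nonneg (α := ℝ) M.card
  linarith

/-- Here `ab` is the first or second step of the path, in either direction; distinct end points
force the other step to be an old edge. Four positions suffice, and the factor 6 matches the bound
for closed triplets. -/
theorem connectedTriples_le_of_add_edge {G G₀ G₁ : SimpleGraph V} {a b : V} (h₀ : G₀ ≤ G)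
    (h₁ : ∀ i j, G₁.Adj i j → G₀.Adj i j ∨ (i = a ∧ j = b) ∨ (i = b ∧ j = a)) :
    (connectedTriples G₁ : ℝ) ≤ connectedTriples G₀ + 6 * (adjDegree G a + adjDegree G b) := by
  classical
  rw [adjDegree_eq_card, adjDegree_eq_card]
  set N := Finset.univ.filter fun j => G.Adj a j
  set M := Finset.univ.filter fun j => G.Adj b j
  have key : connectedTriples G₁ ≤ connectedTriples G₀ + (M.card + N.card + N.card + M.card) := by
    unfold connectedTriples
    refine (Finset.card_le_card (t := (Finset.univ.filter fun t : V × V × V =>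
      G₀.Adj t.1 t.2.1 ∧ G₀.Adj t.2.1 t.2.2 ∧ t.1 ≠ t.2.2) ∪
      (M.image (fun k => (a, b, k)) ∪ N.image (fun k => (b, a, k)) ∪
        N.image (fun k => (k, a, b)) ∪ M.image (fun k => (k, b, a)))) ?_).trans ?_
    · rintro ⟨i, j, k⟩ ht
      simp only [Finset.mem_filter, Finset.mem_univ, true_and, Finset.mem_union, Finset.mem_image,
        Prod.mk.injEq, N, M] at ht ⊢
      obtain ⟨x1, x2, x3⟩ := ht
      have n1 := x1.ne
      have n2 := x2.ne
      have g := fun u v (h : G₀.Adj u v) => h₀ h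
      have y1 := h₁ _ _ x1
      have y2 := h₁ _ _ x2
      have gs := fun u v (h : G.Adj u v) => h.symm
      grind
    · exact (Finset.card_union_le _ _).trans (Nat.add_le_add_left
        ((Finset.card_union_le _ _).trans (add_le_add ((Finset.card_union_le _ _).trans
        (add_le_add ((Finset.card_union_le _ _).trans (add_le_add Finset.card_image_le
        Finset.card_image_le)) Finset.card_image_le)) Finset.card_image_le)) _)
  have key' : (connectedTriples G₁ : ℝ) ≤ connectedTriples G₀ +
      (M.card + N.card + N.card + M.card) := by exact_mod_cast key
  have := Nat.cast_nonneg (α := ℝ) M.card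
  have := Nat.cast_nonneg (α := ℝ) N.card
  linarith

end TripleCounts

/-! ### Edge probabilities, zero on the diagonal -/

section EdgeProb

variable {V : Type*} [DecidableEq V] {q : Sym2 V → ℝ}

/-- The probability that `i` and `j` are adjacent. -/
def edgeProb (q : Sym2 V → ℝ) (i j : V) : ℝ := if i = j then 0 else q s(i, j)

theorem edgeProb_comm (i j : V) : edgeProb q i j = edgeProb q j i := by
  simp only [edgeProb, eq_comm (a := i), Sym2.eq_swap (a := i)]

theorem edgeProb_nonneg (hq : ∀ e, q e ∈ Set.Icc (0 : ℝ) 1) (i j : V) : 0 ≤ edgeProb q i j := by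
  unfold edgeProb
  split_ifs
  exacts [le_rfl, (hq _).1]

theorem adjIndicator_fromEdgeSet (S : Finset (Sym2 V)) {i j : V} (hij : i ≠ j) :
    adjIndicator (SimpleGraph.fromEdgeSet (S : Set (Sym2 V))) i j =
      if s(i, j) ∈ S then 1 else 0 := by
  simp [adjIndicator, hij]

end EdgeProb

/-! ### Moments of the triple counts in a graph with independent edges -/

section GraphExpect

variable {V : Type*} [Fintype V] [DecidableEq V]

/-- The expectation of `F G`, where `G` is the random simple graph on `V` that contains each edge
`e` independently with probability `q e`. -/
noncomputable def graphExpect (q : Sym2 V → ℝ) (F : SimpleGraph V → ℝ) : ℝ :=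
  bernoulliExpect q (Finset.univ.filter fun e : Sym2 V => ¬ e.IsDiag)
    fun S => F (SimpleGraph.fromEdgeSet (S : Set (Sym2 V)))

variable {q : Sym2 V → ℝ} {F H : SimpleGraph V → ℝ}

theorem graphExpect_sum {ι : Type*} (I : Finset ι) (F : ι → SimpleGraph V → ℝ) :
    graphExpect q (fun G => ∑ i ∈ I, F i G) = ∑ i ∈ I, graphExpect q (F i) :=
  bernoulliExpect_sum _ _

theorem graphExpect_const (c : ℝ) : graphExpect q (fun _ => c) = c := bernoulliExpect_const c

theorem graphExpect_add :
    graphExpect q (fun G => F G + H G) = graphExpect q F + graphExpect q H := bernoulliExpect_add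

theorem graphExpect_const_mul (c : ℝ) :
    graphExpect q (fun G => c * F G) = c * graphExpect q F := bernoulliExpect_const_mul c

theorem graphExpect_mono (hq : ∀ e, q e ∈ Set.Icc (0 : ℝ) 1) (h : ∀ G, F G ≤ H G) :
    graphExpect q F ≤ graphExpect q H := bernoulliExpect_mono hq fun _ _ => h _

/-- The probability that all edges of `A` are present. -/
theorem graphExpect_subset {A : Finset (Sym2 V)} (hA : ∀ e ∈ A, ¬ e.IsDiag)
    (hF : ∀ S : Finset (Sym2 V),
      F (SimpleGraph.fromEdgeSet (S : Set (Sym2 V))) = if A ⊆ S then 1 else 0) :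
    graphExpect q F = ∏ e ∈ A, q e := by
  rw [graphExpect, ← bernoulliExpect_subset (s := Finset.univ.filter fun e : Sym2 V => ¬ e.IsDiag)
    (fun e he => by simpa using hA e he)]
  simp only [hF]

theorem graphExpect_adjIndicator (i j : V) :
    graphExpect q (fun G => adjIndicator G i j) = edgeProb q i j := by
  by_cases hij : i = j
  · simp [hij, adjIndicator_self, graphExpect_const, edgeProb]
  · rw [graphExpect_subset (A := {s(i, j)}) (by simp [hij])
      (fun S => by simp [adjIndicator_fromEdgeSet S hij])]
    simp [edgeProb, hij]

/-- `i ≠ k` makes the two edges distinct, hence independent; loops make both sides vanish. -/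
theorem graphExpect_adjIndicator_mul {i j k : V} (hik : i ≠ k) :
    graphExpect q (fun G => adjIndicator G i j * adjIndicator G j k) =
      edgeProb q i j * edgeProb q j k := by
  by_cases hij : i = j
  · simp [hij, adjIndicator_self, graphExpect_const, edgeProb]
  by_cases hjk : j = k
  · simp [hjk, adjIndicator_self, graphExpect_const, edgeProb]
  rw [graphExpect_subset (A := {s(i, j), s(j, k)}) (by simp [hij, hjk]) (fun S => ?_)]
  · rw [Finset.prod_pair (by simp [hij, hik])]
    simp [edgeProb, hij, hjk]
  · rw [adjIndicator_fromEdgeSet S hij, adjIndicator_fromEdgeSet S hjk]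
    simp only [Finset.insert_subset_iff, Finset.singleton_subset_iff]
    split_ifs <;> simp_all

theorem graphExpect_adjIndicator_mul_mul (i j k : V) :
    graphExpect q (fun G => adjIndicator G i j * adjIndicator G j k * adjIndicator G k i) =
      edgeProb q i j * edgeProb q j k * edgeProb q k i := by
  by_cases hij : i = j
  · simp [hij, adjIndicator_self, graphExpect_const, edgeProb]
  by_cases hjk : j = k
  · simp [hjk, adjIndicator_self, graphExpect_const, edgeProb]
  by_cases hki : k = i
  · simp [hki, adjIndicator_self, graphExpect_const, edgeProb]
  rw [graphExpect_subset (A := {s(i, j), s(j, k), s(k, i)}) (by simp [hij, hjk, hki])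
    (fun S => ?_)]
  · rw [Finset.prod_insert (by simp [hij, Ne.symm hki, hjk]),
      Finset.prod_pair (by simp [hjk, Ne.symm hij])]
    simp [edgeProb, hij, hjk, hki, mul_assoc]
  · rw [adjIndicator_fromEdgeSet S hij, adjIndicator_fromEdgeSet S hjk,
      adjIndicator_fromEdgeSet S hki]
    simp only [Finset.insert_subset_iff, Finset.singleton_subset_iff]
    split_ifs <;> simp_all

theorem graphExpect_closedTriplets :
    graphExpect q (fun G => (closedTriplets G : ℝ)) =
      ∑ i, ∑ j, ∑ k, edgeProb q i j * edgeProb q j k * edgeProb q k i := by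
  simp only [closedTriplets_eq_sum, graphExpect_sum, graphExpect_adjIndicator_mul_mul]

theorem graphExpect_connectedTriples :
    graphExpect q (fun G => (connectedTriples G : ℝ)) =
      ∑ j, ((∑ i, edgeProb q j i) ^ 2 - ∑ i, edgeProb q j i ^ 2) := by
  simp only [connectedTriples_eq_sum, graphExpect_sum]
  rw [Finset.sum_comm]
  refine Finset.sum_congr rfl fun j _ => ?_
  have h : ∀ i k, graphExpect q (fun G => if i = k then 0 else
      adjIndicator G i j * adjIndicator G j k) =
      edgeProb q j i * edgeProb q j k - if i = k then edgeProb q j i * edgeProb q j k else 0 := by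
    intro i k
    by_cases hik : i = k
    · simp [hik, graphExpect_const]
    · simp only [hik, if_false]
      rw [graphExpect_adjIndicator_mul hik, edgeProb_comm i j, sub_zero]
  simp only [h, Finset.sum_sub_distrib, Finset.sum_ite_eq, Finset.mem_univ, if_true, sq,
    Finset.sum_mul_sum]

/-- The degree is a sum of independent indicators, so its variance is at most its mean. -/
theorem graphExpect_adjDegree_sq_le (hq : ∀ e, q e ∈ Set.Icc (0 : ℝ) 1) {μ : ℝ} {a : V}
    (hμ : ∑ j, edgeProb q a j ≤ μ) :
    graphExpect q (fun G => adjDegree G a ^ 2) ≤ μ ^ 2 + μ := by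
  have h0 : 0 ≤ ∑ j, edgeProb q a j := Finset.sum_nonneg fun j _ => edgeProb_nonneg hq a j
  have h : ∀ j k, graphExpect q (fun G => adjIndicator G a j * adjIndicator G a k) ≤
      edgeProb q a j * edgeProb q a k + if j = k then edgeProb q a j else 0 := by
    intro j k
    by_cases hjk : j = k
    · subst hjk
      simp only [adjIndicator_mul_self, graphExpect_adjIndicator, if_true]
      nlinarith [edgeProb_nonneg hq a j]
    · have := graphExpect_adjIndicator_mul (q := q) (j := a) hjk
      simp only [adjIndicator_comm _ j a, edgeProb_comm j a] at this
      simp [this, hjk]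
  calc graphExpect q (fun G => adjDegree G a ^ 2)
      = ∑ j, ∑ k, graphExpect q (fun G => adjIndicator G a j * adjIndicator G a k) := by
        simp only [adjDegree, sq, Finset.sum_mul_sum, graphExpect_sum]
    _ ≤ ∑ j, ∑ k, (edgeProb q a j * edgeProb q a k + if j = k then edgeProb q a j else 0) :=
        Finset.sum_le_sum fun j _ => Finset.sum_le_sum fun k _ => h j k
    _ = (∑ j, edgeProb q a j) ^ 2 + ∑ j, edgeProb q a j := by
        simp only [Finset.sum_add_distrib, Finset.sum_ite_eq, Finset.mem_univ, if_true, sq,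
          Finset.sum_mul_sum]
    _ ≤ μ ^ 2 + μ := by gcongr

theorem sum_edge_le {n : ℕ} {q : Sym2 (Fin n) → ℝ} (hq : ∀ e, q e ∈ Set.Icc (0 : ℝ) 1) {μ : ℝ}
    (hμ : ∀ a, ∑ j, edgeProb q a j ≤ μ) :
    ∑ e ∈ Finset.univ.filter (fun e : Sym2 (Fin n) => ¬ e.IsDiag), q e ≤ n * μ := by
  have h := Finset.sum_sym2_filter_not_isDiag (Finset.univ : Finset (Fin n)) q
  rw [Finset.sym2_univ] at h
  calc _ = ∑ i ∈ (Finset.univ : Finset (Fin n)).offDiag with i.1 < i.2, q s(i.1, i.2) := by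
        rw [← h]
    _ ≤ ∑ i : Fin n × Fin n, edgeProb q i.1 i.2 := by
        refine (Finset.sum_le_sum (g := fun i => edgeProb q i.1 i.2) fun i hi => ?_).trans
          (Finset.sum_le_sum_of_subset_of_nonneg (Finset.subset_univ _)
            fun i _ _ => edgeProb_nonneg hq _ _)
        rw [edgeProb, if_neg (Finset.mem_filter.1 hi).2.ne]
    _ ≤ n * μ := by
        rw [Fintype.sum_prod_type]
        refine (Finset.sum_le_sum fun i _ => hμ i).trans ?_
        simp

/-- A second moment bound for monotone functions of a random graph that increase by at most a
multiple of the degrees of the end points when an edge is added. -/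
theorem graphExpect_sub_sq_le {n : ℕ} {q : Sym2 (Fin n) → ℝ}
    (hq : ∀ e, q e ∈ Set.Icc (0 : ℝ) 1) {μ : ℝ} (hμ : ∀ a, ∑ j, edgeProb q a j ≤ μ)
    (hμ0 : 0 ≤ μ) {F : SimpleGraph (Fin n) → ℝ} (hmono : ∀ G H, G ≤ H → F G ≤ F H)
    (hadd : ∀ (G G₀ G₁ : SimpleGraph (Fin n)) (a b : Fin n), G₀ ≤ G →
      (∀ i j, G₁.Adj i j → G₀.Adj i j ∨ (i = a ∧ j = b) ∨ (i = b ∧ j = a)) →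
      F G₁ ≤ F G₀ + 6 * (adjDegree G a + adjDegree G b)) (m : ℝ) :
    graphExpect q (fun G => (F G - m) ^ 2) ≤
      (graphExpect q F - m) ^ 2 + n * μ * (144 * (μ ^ 2 + μ)) := by
  refine (bernoulliExpect_sub_sq_le hq m).trans (add_le_add le_rfl ?_)
  calc _ ≤ ∑ e ∈ Finset.univ.filter (fun e : Sym2 (Fin n) => ¬ e.IsDiag),
        q e * (144 * (μ ^ 2 + μ)) := by
        refine Finset.sum_le_sum fun e _ => mul_le_mul_of_nonneg_left ?_ (hq e).1
        induction e using Sym2.ind with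
        | _ a b =>
          -- The increment squared is at most `36 * (x + y) ^ 2 ≤ 72 * (x ^ 2 + y ^ 2)`, and each
          -- squared degree has mean at most `μ ^ 2 + μ`.
          have hb : graphExpect q (fun G => 72 * (adjDegree G a ^ 2 + adjDegree G b ^ 2)) ≤
              144 * (μ ^ 2 + μ) := by
            rw [graphExpect_const_mul, graphExpect_add]
            linarith [graphExpect_adjDegree_sq_le hq (hμ a), graphExpect_adjDegree_sq_le hq (hμ b)]
          refine (bernoulliExpect_mono hq fun S _ => ?_).trans hb
          have h1 := hadd (SimpleGraph.fromEdgeSet (S : Set (Sym2 (Fin n))))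
            (SimpleGraph.fromEdgeSet ((S.erase s(a, b) : Finset _) : Set (Sym2 (Fin n))))
            (SimpleGraph.fromEdgeSet ((insert s(a, b) S : Finset _) : Set (Sym2 (Fin n)))) a b
            (SimpleGraph.fromEdgeSet_mono (by simp)) (fun i j hij => by
              simp only [SimpleGraph.fromEdgeSet_adj, Finset.coe_insert, Finset.coe_erase,
                Set.mem_insert_iff, Set.mem_sdiff, Set.mem_singleton_iff] at hij ⊢
              have := Sym2.eq_iff (x := i) (y := j) (z := a) (w := b)
              tauto)
          have h2 := hmono
            (SimpleGraph.fromEdgeSet ((S.erase s(a, b) : Finset _) : Set (Sym2 (Fin n))))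
            (SimpleGraph.fromEdgeSet ((insert s(a, b) S : Finset _) : Set (Sym2 (Fin n))))
            (SimpleGraph.fromEdgeSet_mono (Finset.coe_subset.2
              ((Finset.erase_subset _ _).trans (Finset.subset_insert _ _))))
          set x := adjDegree (SimpleGraph.fromEdgeSet (S : Set (Sym2 (Fin n)))) a
          set y := adjDegree (SimpleGraph.fromEdgeSet (S : Set (Sym2 (Fin n)))) b
          refine (pow_le_pow_left₀ (sub_nonneg.2 h2) (sub_le_iff_le_add'.2 h1) 2).trans ?_
          nlinarith [sq_nonneg (x - y)]
    _ ≤ n * μ * (144 * (μ ^ 2 + μ)) := by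
        rw [← Finset.sum_mul]
        exact mul_le_mul_of_nonneg_right (sum_edge_le hq hμ) (by positivity)

end GraphExpect

/-! ### Exact sums of the edge probabilities over balanced blocks -/

section BlockSums

/-- The edge probabilities given the labels `z` of the four parameter Stochastic Blockmodel. -/
noncomputable def blockProb {V B : Type*} [DecidableEq B] (p r : ℝ) (z : V → B) (e : Sym2 V) : ℝ :=
  if (e.map z).IsDiag then p else r

variable {n K s : ℕ} {p r M : ℝ} {z : Fin n → Fin K}

theorem blockProb_mk (i j : Fin n) : blockProb p r z s(i, j) = if z i = z j then p else r := by
  simp [blockProb]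

theorem blockProb_mem (hp : p ∈ Set.Icc (0 : ℝ) 1) (hr : r ∈ Set.Icc (0 : ℝ) 1)
    (e : Sym2 (Fin n)) : blockProb p r z e ∈ Set.Icc (0 : ℝ) 1 := by
  unfold blockProb
  split_ifs
  exacts [hp, hr]

theorem sum_same_block (hz : ∀ a, (Finset.univ.filter fun i => z i = a).card = s) (i : Fin n) :
    ∑ j, (if z i = z j then (1 : ℝ) else 0) = s := by
  simp only [eq_comm (a := z i)]
  simp [hz]

theorem sum_edgeProb_blockProb (hz : ∀ a, (Finset.univ.filter fun i => z i = a).card = s)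
    (i : Fin n) :
    ∑ j, edgeProb (blockProb p r z) i j = ((s : ℝ) - 1) * p + ((n : ℝ) - s) * r := by
  have h : ∀ j, edgeProb (blockProb p r z) i j =
      r + (p - r) * (if z i = z j then 1 else 0) - if i = j then p else 0 := by
    intro j
    by_cases hij : i = j
    · simp [edgeProb, hij]
    · simp only [edgeProb, hij, if_false, blockProb_mk]
      split_ifs <;> ring
  simp only [h, Finset.sum_sub_distrib, Finset.sum_add_distrib, ← Finset.mul_sum,
    sum_same_block hz, Finset.sum_ite_eq, Finset.mem_univ, if_true, Finset.sum_const,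
    Finset.card_univ, Fintype.card_fin, nsmul_eq_mul]
  ring

theorem sum_edgeProb_blockProb_sq (hz : ∀ a, (Finset.univ.filter fun i => z i = a).card = s)
    (i : Fin n) :
    ∑ j, edgeProb (blockProb p r z) i j ^ 2 = ((s : ℝ) - 1) * p ^ 2 + ((n : ℝ) - s) * r ^ 2 := by
  -- Squared edge probabilities are those of the model with parameters `p ^ 2`, `r ^ 2`.
  rw [← sum_edgeProb_blockProb hz i]
  refine Finset.sum_congr rfl fun j _ => ?_
  simp only [edgeProb, blockProb_mk]
  split_ifs <;> simp

/-- The number of ordered triples of distinct nodes in the same block. -/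
theorem sum_same_block_triples (hz : ∀ a, (Finset.univ.filter fun i => z i = a).card = s) :
    ∑ i, ∑ j, ∑ k, edgeProb (blockProb 1 0 z) i j * edgeProb (blockProb 1 0 z) j k *
      edgeProb (blockProb 1 0 z) k i = n * (((s : ℝ) - 1) * ((s : ℝ) - 2)) := by
  have h : ∀ i j, ∑ k, edgeProb (blockProb 1 0 z) i j * edgeProb (blockProb 1 0 z) j k *
      edgeProb (blockProb 1 0 z) k i = edgeProb (blockProb 1 0 z) i j * ((s : ℝ) - 2) := by
    intro i j
    simp only [mul_assoc, ← Finset.mul_sum]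
    by_cases hij : i = j
    · simp [edgeProb, hij]
    by_cases hzij : z i = z j
    · congr 1
      -- The admissible `k` are the members of the common block other than `i` and `j`.
      have h' : ∀ k, edgeProb (blockProb 1 0 z) j k * edgeProb (blockProb 1 0 z) k i =
          (if z i = z k then (1 : ℝ) else 0) - (if i = k then 1 else 0) -
            if j = k then 1 else 0 := by
        intro k
        simp only [edgeProb, blockProb_mk]
        by_cases h1 : i = k
        · subst h1
          simp [Ne.symm hij]
        by_cases h2 : j = k
        · subst h2
          simp [hij, hzij]
        by_cases h3 : z i = z k
        · simp [h1, h2, h3, Ne.symm h1, ← hzij]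
        · simp [h1, h2, h3, Ne.symm h3, Ne.symm h1, ← hzij]
      simp only [h', Finset.sum_sub_distrib, sum_same_block hz, Finset.sum_ite_eq,
        Finset.mem_univ, if_true]
      ring
    · simp [edgeProb, blockProb_mk, hzij]
  simp only [h, ← Finset.sum_mul, sum_edgeProb_blockProb hz]
  simp
  ring

/-- Sharing a block is transitive, so a triangle has zero, two or three between-block edges: the
difference is `0`, `p * r ^ 2` or `r ^ 3`. Keeping one edge probability beside `r ^ 2` leaves only
one free vertex when summing over triples. -/
theorem abs_edgeProb_triangle_sub_le (hp : p ∈ Set.Icc (0 : ℝ) 1) (hr : r ∈ Set.Icc (0 : ℝ) 1)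
    (i j k : Fin n) :
    |edgeProb (blockProb p r z) i j * edgeProb (blockProb p r z) j k *
        edgeProb (blockProb p r z) k i -
      p ^ 3 * (edgeProb (blockProb 1 0 z) i j * edgeProb (blockProb 1 0 z) j k *
        edgeProb (blockProb 1 0 z) k i)| ≤
      r ^ 2 * (edgeProb (blockProb p r z) i j + edgeProb (blockProb p r z) j k +
        edgeProb (blockProb p r z) k i) := by
  have hq := blockProb_mem (z := z) hp hr
  have e1 := edgeProb_nonneg hq i j
  have e2 := edgeProb_nonneg hq j k
  have e3 := edgeProb_nonneg hq k i
  have hR : 0 ≤ r ^ 2 * (edgeProb (blockProb p r z) i j + edgeProb (blockProb p r z) j k +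
        edgeProb (blockProb p r z) k i) := by positivity
  by_cases hij : i = j
  · simpa [edgeProb, hij] using hR
  by_cases hjk : j = k
  · simpa [edgeProb, hjk] using hR
  by_cases hki : k = i
  · simpa [edgeProb, hki] using hR
  obtain ⟨hp0, hp1⟩ := hp
  obtain ⟨hr0, hr1⟩ := hr
  simp only [edgeProb, blockProb_mk, hij, hjk, hki, if_false]
  have hpr : 0 ≤ p * r ^ 2 := by positivity
  have hrr : 0 ≤ r ^ 3 := by positivity
  by_cases h1 : z i = z j
  · by_cases h2 : z j = z k
    · rw [if_pos h1, if_pos h2, if_pos (h1.trans h2).symm, if_pos h1, if_pos h2,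
        if_pos (h1.trans h2).symm, abs_le]
      constructor <;> nlinarith
    · have h3 : z k ≠ z i := fun h => h2 (h.trans h1).symm
      rw [if_pos h1, if_neg h2, if_neg h3, if_pos h1, if_neg h2, if_neg h3, abs_le]
      constructor <;> nlinarith
  · rw [if_neg h1, if_neg h1]
    by_cases h2 : z j = z k
    · have h3 : z k ≠ z i := fun h => h1 (h2.trans h).symm
      rw [if_pos h2, if_neg h3, if_pos h2, if_neg h3, abs_le]
      constructor <;> nlinarith
    · rw [if_neg h2, if_neg h2]
      split_ifs <;> rw [abs_le] <;> constructor <;> nlinarith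

end BlockSums

/-! ### From the law of the blockmodel to conditional expectations -/

section Law

theorem Finset.prod_not_isDiag {n : ℕ} (f : Sym2 (Fin n) → ℝ) :
    ∏ e ∈ Finset.univ.filter (fun e : Sym2 (Fin n) => ¬ e.IsDiag), f e =
      ∏ i : Fin n, ∏ j ∈ Finset.Ioi i, f s(i, j) := by
  -- The product is read as a sum in `Additive ℝ`.
  have h := Finset.sum_sym2_filter_not_isDiag (M := Additive ℝ) (Finset.univ : Finset (Fin n)) f
  rw [Finset.sym2_univ] at h
  refine (show _ = ∏ i ∈ (Finset.univ : Finset (Fin n)).offDiag with i.1 < i.2, f s(i.1, i.2)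
    from h).trans ?_
  rw [Finset.prod_sigma']
  refine Finset.prod_bij' (fun i _ => ⟨i.1, i.2⟩) (fun i _ => (i.1, i.2)) ?_ ?_ ?_ ?_ ?_
  · simp
  · simp +contextual [ne_of_lt]
  all_goals simp

-- Loopless edge sets correspond bijectively to simple graphs; the weights become the products in
-- `IsStochasticBlockmodel.law`.
open Classical in
theorem graphExpect_eq_sum {n : ℕ} (q : Sym2 (Fin n) → ℝ) (F : SimpleGraph (Fin n) → ℝ) :
    graphExpect q F = ∑ g : SimpleGraph (Fin n), (∏ i : Fin n, ∏ j ∈ Finset.Ioi i,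
      if g.Adj i j then q s(i, j) else 1 - q s(i, j)) * F g := by
  unfold graphExpect bernoulliExpect
  refine Finset.sum_bij' (fun S _ => SimpleGraph.fromEdgeSet (S : Set (Sym2 (Fin n))))
    (fun g _ => Finset.univ.filter fun e => e ∈ g.edgeSet) ?_ ?_ ?_ ?_ ?_
  · simp
  · intro g _
    rw [Finset.mem_powerset]
    intro e he
    simp only [Finset.mem_filter, Finset.mem_univ, true_and] at he ⊢
    exact g.not_isDiag_of_mem_edgeSet he
  · intro S hS
    ext e
    have := fun h : e ∈ S => (Finset.mem_filter.1 (Finset.mem_powerset.1 hS h)).2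
    simp only [SimpleGraph.edgeSet_fromEdgeSet, Finset.mem_filter, Finset.mem_univ, true_and,
      Set.mem_sdiff, Finset.mem_coe, Sym2.mem_diagSet]
    tauto
  · intro g _
    simp
  · intro S hS
    congr 1
    trans ∏ e ∈ Finset.univ.filter (fun e : Sym2 (Fin n) => ¬ e.IsDiag),
      if e ∈ S then q e else 1 - q e
    · rw [← Finset.prod_sdiff (Finset.mem_powerset.1 hS), mul_comm]
      congr 1
      · exact Finset.prod_congr rfl fun e he => by simp [(Finset.mem_sdiff.1 he).2]
      · exact Finset.prod_congr rfl fun e he => by simp [he]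
    · rw [Finset.prod_not_isDiag]
      refine Finset.prod_congr rfl fun i _ => Finset.prod_congr rfl fun j hj => ?_
      simp [(Finset.mem_Ioi.1 hj).ne]

open Classical in
/-- A bound on the conditional probability of an event given balanced labels bounds its
probability. -/
theorem IsFourParameterSBM.measureReal_le {Ω : Type*} [MeasurableSpace Ω] {P : Measure Ω}
    [IsProbabilityMeasure P] {K s : ℕ} {p r : ℝ} {ξ : Ω → Fin (K * s) → Fin K}
    {A : Ω → SimpleGraph (Fin (K * s))} (hA : IsFourParameterSBM P K s p r ξ A)
    (Q : SimpleGraph (Fin (K * s)) → Prop) {b : ℝ} (hb : 0 ≤ b)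
    (hQ : ∀ z : Fin (K * s) → Fin K, (∀ a, (Finset.univ.filter fun i => z i = a).card = s) →
      graphExpect (blockProb p r z) (fun g => if Q g then 1 else 0) ≤ b) :
    P.real {ω | Q (A ω)} ≤ b := by
  have hz : ∀ z : Fin (K * s) → Fin K,
      ∑ g, P.real {ω | ξ ω = z ∧ A ω = g} * (if Q g then 1 else 0) ≤ P.real {ω | ξ ω = z} * b := by
    intro z
    have heq : ∑ g, P.real {ω | ξ ω = z ∧ A ω = g} * (if Q g then 1 else 0) =
        P.real {ω | ξ ω = z} *
          graphExpect (blockProb p r z) (fun g => if Q g then 1 else 0) := by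
      rw [graphExpect_eq_sum, Finset.mul_sum]
      refine Finset.sum_congr rfl fun g _ => ?_
      rw [hA.sbm.law z g]
      simp only [blockProb_mk, Matrix.of_apply, mul_assoc]
    rw [heq]
    by_cases hbal : ∀ a, (Finset.univ.filter fun i => z i = a).card = s
    · exact mul_le_mul_of_nonneg_left (hQ z hbal) measureReal_nonneg
    -- Unbalanced labellings have probability zero, so no bound on their conditional probability is
    -- needed.
    · have h0 : P {ω | ξ ω = z} = 0 := by
        refine measure_mono_null (fun ω hω => ?_) (ae_iff.1 hA.blocks)
        rw [Set.mem_ofPred_eq] at hω ⊢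
        rwa [hω]
      simp [Measure.real, h0]
  calc P.real {ω | Q (A ω)}
      ≤ P.real (⋃ x ∈ (Finset.univ : Finset ((Fin (K * s) → Fin K) ×
          SimpleGraph (Fin (K * s)))).filter (fun x => Q x.2), {ω | ξ ω = x.1 ∧ A ω = x.2}) := by
        refine measureReal_mono (fun ω hω => ?_) (measure_ne_top _ _)
        simp only [Set.mem_iUnion]
        exact ⟨(ξ ω, A ω), by simpa using hω, rfl, rfl⟩
    _ ≤ ∑ x ∈ (Finset.univ : Finset ((Fin (K * s) → Fin K) ×
          SimpleGraph (Fin (K * s)))).filter (fun x => Q x.2),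
          P.real {ω | ξ ω = x.1 ∧ A ω = x.2} := measureReal_biUnion_finset_le _ _
    _ = ∑ z, ∑ g, P.real {ω | ξ ω = z ∧ A ω = g} * (if Q g then 1 else 0) := by
        rw [Finset.sum_filter, Fintype.sum_prod_type]
        simp
    _ ≤ ∑ z, P.real {ω | ξ ω = z} * b := Finset.sum_le_sum fun z _ => hz z
    _ = (∑ z, P.real {ω | ξ ω = z}) * b := by rw [Finset.sum_mul]
    _ ≤ 1 * b := by
        refine mul_le_mul_of_nonneg_right ?_ hb
        rw [← measureReal_biUnion_finset (fun z _ w _ hzw => ?_)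
          (fun z _ => hA.sbm.measurableSet_label z)]
        · exact measureReal_le_one
        · exact Set.disjoint_left.2 fun ω h1 h2 => hzw (h1.symm.trans h2)
    _ = b := one_mul b

end Law

/-! ### Means, second moments and the ratio -/

section Concentration

variable {n K s : ℕ} {p r M : ℝ} {z : Fin n → Fin K}

theorem sum_edgeProb_blockProb_le (hp : p ∈ Set.Icc (0 : ℝ) 1) (hr : r ∈ Set.Icc (0 : ℝ) 1)
    (hM : n * r ≤ M) (hz : ∀ a, (Finset.univ.filter fun i => z i = a).card = s) (i : Fin n) :
    ∑ j, edgeProb (blockProb p r z) i j ≤ s + M := by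
  rw [sum_edgeProb_blockProb hz]
  have h1 : (s : ℝ) * p ≤ s := mul_le_of_le_one_right (Nat.cast_nonneg _) hp.2
  have h2 : 0 ≤ (s : ℝ) * r := mul_nonneg (Nat.cast_nonneg _) hr.1
  linarith [hp.1]

theorem abs_graphExpect_closedTriplets_sub_le (hp : p ∈ Set.Icc (0 : ℝ) 1)
    (hr : r ∈ Set.Icc (0 : ℝ) 1) (hM : n * r ≤ M)
    (hz : ∀ a, (Finset.univ.filter fun i => z i = a).card = s) :
    |graphExpect (blockProb p r z) (fun G => (closedTriplets G : ℝ)) -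
      n * (((s : ℝ) - 1) * ((s : ℝ) - 2) * p ^ 3)| ≤ 3 * M ^ 2 * (s + M) := by
  have hnr : 0 ≤ n * r := mul_nonneg (Nat.cast_nonneg _) hr.1
  have hμ := sum_edgeProb_blockProb_le hp hr hM hz
  have e : (n : ℝ) * (((s : ℝ) - 1) * ((s : ℝ) - 2) * p ^ 3) =
      ∑ i, ∑ j, ∑ k, p ^ 3 * (edgeProb (blockProb 1 0 z) i j * edgeProb (blockProb 1 0 z) j k *
        edgeProb (blockProb 1 0 z) k i) := by
    simp only [← Finset.mul_sum, sum_same_block_triples hz]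
    ring
  rw [graphExpect_closedTriplets, e]
  simp only [← Finset.sum_sub_distrib]
  have hE : ∑ i, ∑ j, edgeProb (blockProb p r z) i j ≤ n * (s + M) := by
    refine (Finset.sum_le_sum fun i _ => hμ i).trans_eq ?_
    rw [Finset.sum_const, Finset.card_univ, Fintype.card_fin, nsmul_eq_mul]
  calc _ ≤ ∑ i, ∑ j, ∑ k, r ^ 2 * (edgeProb (blockProb p r z) i j +
        edgeProb (blockProb p r z) j k + edgeProb (blockProb p r z) k i) :=
        (Finset.abs_sum_le_sum_abs _ _).trans <| Finset.sum_le_sum fun i _ =>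
          (Finset.abs_sum_le_sum_abs _ _).trans <| Finset.sum_le_sum fun j _ =>
          (Finset.abs_sum_le_sum_abs _ _).trans <| Finset.sum_le_sum fun k _ =>
          abs_edgeProb_triangle_sub_le hp hr i j k
    -- Each of the three edges leaves one vertex free, giving a factor `n`; the total `n * r ^ 2 *
    -- n` is `(n * r) ^ 2`, which stays bounded.
    _ = 3 * (n * r ^ 2) * ∑ i, ∑ j, edgeProb (blockProb p r z) i j := by
        simp only [← Finset.mul_sum, Finset.sum_add_distrib, Finset.sum_const, Finset.card_univ,
          Fintype.card_fin, nsmul_eq_mul]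
        rw [Finset.sum_comm (f := fun i k => edgeProb (blockProb p r z) k i)]
        ring
    _ ≤ 3 * (n * r ^ 2) * (n * (s + M)) := by
        have := mul_nonneg (Nat.cast_nonneg (α := ℝ) n) (sq_nonneg r)
        gcongr
    _ = 3 * (n * r) ^ 2 * (s + M) := by ring
    _ ≤ 3 * M ^ 2 * (s + M) := by
        have : 0 ≤ M := hnr.trans hM
        gcongr

/-- Replacing `(n - s) * r` by `n * r` and dropping the between-block part of the sum of squares
costs `O(r)` per node, hence `O(1)` over all nodes. -/
theorem abs_graphExpect_connectedTriples_sub_le (hs : 1 ≤ s) (hp : p ∈ Set.Icc (0 : ℝ) 1)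
    (hr : r ∈ Set.Icc (0 : ℝ) 1) (hM : n * r ≤ M)
    (hz : ∀ a, (Finset.univ.filter fun i => z i = a).card = s) :
    |graphExpect (blockProb p r z) (fun G => (connectedTriples G : ℝ)) -
      n * (((s : ℝ) - 1) * ((s : ℝ) - 2) * p ^ 2 + 2 * ((s : ℝ) - 1) * p * (n * r) +
        (n * r) ^ 2)| ≤ 3 * s ^ 2 * M + 2 * s * M ^ 2 + M ^ 2 + s * M := by
  have hs' : (1 : ℝ) ≤ s := by exact_mod_cast hs
  set x : ℝ := n * r with hx
  have hx0 : 0 ≤ x := mul_nonneg (Nat.cast_nonneg _) hr.1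
  have e : graphExpect (blockProb p r z) (fun G => (connectedTriples G : ℝ)) -
      n * (((s : ℝ) - 1) * ((s : ℝ) - 2) * p ^ 2 + 2 * ((s : ℝ) - 1) * p * x + x ^ 2) =
      (s ^ 2 * (x * r) + s * (x * r)) - (2 * ((s - 1) * s) * (x * p) + 2 * s * x ^ 2 + x ^ 2) := by
    rw [graphExpect_connectedTriples]
    simp only [sum_edgeProb_blockProb hz, sum_edgeProb_blockProb_sq hz, Finset.sum_const,
      Finset.card_univ, Fintype.card_fin, nsmul_eq_mul, hx]
    ring
  have h1 : x * r ≤ M := (mul_le_of_le_one_right hx0 hr.2).trans hM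
  have h2 : x * p ≤ M := (mul_le_of_le_one_right hx0 hp.2).trans hM
  have h1' : 0 ≤ x * r := mul_nonneg hx0 hr.1
  have h2' : 0 ≤ x * p := mul_nonneg hx0 hp.1
  have h3 : x ^ 2 ≤ M ^ 2 := pow_le_pow_left₀ hx0 hM 2
  have hM0 : 0 ≤ M := hx0.trans hM
  have h4 : ((s : ℝ) - 1) * s * (x * p) ≤ s ^ 2 * M := by
    refine mul_le_mul ?_ h2 h2' (sq_nonneg _)
    nlinarith
  have h5 : (s : ℝ) ^ 2 * (x * r) ≤ s ^ 2 * M := by gcongr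
  have h6 : (s : ℝ) * (x * r) ≤ s * M := by gcongr
  have h7 : (s : ℝ) * x ^ 2 ≤ s * M ^ 2 := by gcongr
  have n1 : 0 ≤ (s : ℝ) ^ 2 * (x * r) := by positivity
  have n2 : 0 ≤ (s : ℝ) * (x * r) := by positivity
  have n3 : 0 ≤ ((s : ℝ) - 1) * s * (x * p) :=
    mul_nonneg (mul_nonneg (by linarith) (by linarith)) h2'
  have n4 : 0 ≤ (s : ℝ) * x ^ 2 := by positivity
  have n5 : 0 ≤ (s : ℝ) * M ^ 2 := by positivity
  have n6 : 0 ≤ (s : ℝ) ^ 2 * M := by positivity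
  have n7 : 0 ≤ (s : ℝ) * M := by positivity
  rw [e, abs_le]
  constructor <;> nlinarith [sq_nonneg x, sq_nonneg M]

/-- The second moments of the triple counts about their limiting means are at most linear in the
number of nodes. -/
theorem exists_second_moment_le (s : ℕ) (hs : 1 ≤ s) (M : ℝ) (hM0 : 0 ≤ M) :
    ∃ D : ℝ, 0 ≤ D ∧ ∀ (n K : ℕ) (p r : ℝ) (z : Fin n → Fin K), 1 ≤ n →
      p ∈ Set.Icc (0 : ℝ) 1 → r ∈ Set.Icc (0 : ℝ) 1 → n * r ≤ M →
      (∀ a, (Finset.univ.filter fun i => z i = a).card = s) →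
      graphExpect (blockProb p r z) (fun G =>
        ((closedTriplets G : ℝ) - n * (((s : ℝ) - 1) * ((s : ℝ) - 2) * p ^ 3)) ^ 2 +
        ((connectedTriples G : ℝ) - n * (((s : ℝ) - 1) * ((s : ℝ) - 2) * p ^ 2 +
          2 * ((s : ℝ) - 1) * p * (n * r) + (n * r) ^ 2)) ^ 2) ≤ D * n := by
  set D₁ : ℝ := 3 * M ^ 2 * (s + M)
  set D₂ : ℝ := 3 * s ^ 2 * M + 2 * s * M ^ 2 + M ^ 2 + s * M
  set D₃ : ℝ := (s + M) * (144 * ((s + M) ^ 2 + (s + M)))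
  refine ⟨D₁ ^ 2 + D₂ ^ 2 + 2 * D₃, by positivity, fun n K p r z hn hp hr hM hz => ?_⟩
  have hμ := sum_edgeProb_blockProb_le hp hr hM hz
  have hq := blockProb_mem (z := z) hp hr
  have hμ0 : (0 : ℝ) ≤ s + M := by positivity
  have h1 := graphExpect_sub_sq_le hq hμ hμ0 (F := fun G => (closedTriplets G : ℝ))
    (fun G H h => Nat.cast_le.2 (closedTriplets_mono h))
    (fun G G₀ G₁ a b h₀ h₁ => closedTriplets_le_of_add_edge h₀ h₁)
    (n * (((s : ℝ) - 1) * ((s : ℝ) - 2) * p ^ 3))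
  have h2 := graphExpect_sub_sq_le hq hμ hμ0 (F := fun G => (connectedTriples G : ℝ))
    (fun G H h => Nat.cast_le.2 (connectedTriples_mono h))
    (fun G G₀ G₁ a b h₀ h₁ => connectedTriples_le_of_add_edge h₀ h₁)
    (n * (((s : ℝ) - 1) * ((s : ℝ) - 2) * p ^ 2 + 2 * ((s : ℝ) - 1) * p * (n * r) + (n * r) ^ 2))
  have h3 := pow_le_pow_left₀ (abs_nonneg _)
    (abs_graphExpect_closedTriplets_sub_le hp hr hM hz) 2
  have h4 := pow_le_pow_left₀ (abs_nonneg _)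
    (abs_graphExpect_connectedTriples_sub_le hs hp hr hM hz) 2
  rw [sq_abs] at h3 h4
  rw [graphExpect_add]
  refine (add_le_add h1 h2).trans ?_
  have hn' : (1 : ℝ) ≤ n := by exact_mod_cast hn
  -- The squared biases are bounded, so `1 ≤ n` absorbs them into a linear bound.
  have h5 : D₁ ^ 2 + D₂ ^ 2 ≤ (D₁ ^ 2 + D₂ ^ 2) * n := le_mul_of_one_le_right (by positivity) hn'
  have h6 : (n : ℝ) * (s + M) * (144 * ((s + M) ^ 2 + (s + M))) = D₃ * n := by
    simp only [D₃]
    ring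
  rw [h6]
  linarith

/-- If numerator and denominator are close to `n * t` and `n * c`, the ratio is close to `t / c`. -/
theorem abs_div_sub_div_lt {n t c m η δ T C : ℝ} (hn : 0 < n) (ht : 0 ≤ t) (htc : t ≤ c)
    (hm : 0 < m) (hmc : m ≤ c) (hη : 2 * η ≤ m) (hηδ : 4 * η ≤ δ * m)
    (hT : |T - n * t| < η * n) (hC : |C - n * c| < η * n) : |T / C - t / c| < δ := by
  have hc : 0 < c := hm.trans_le hmc
  rw [abs_lt] at hT hC
  have hη0 : 0 < η := by
    by_contra h
    nlinarith [mul_nonneg (neg_nonneg.2 (not_lt.1 h)) hn.le]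
  -- `2 * η ≤ m ≤ c` keeps the denominator above half its target.
  have hCn : n * c / 2 ≤ C := by nlinarith
  have hnc : 0 < n * c := mul_pos hn hc
  have hC0 : 0 < C := by linarith
  have hδ : 0 < δ := by
    by_contra h
    nlinarith [mul_nonneg (neg_nonneg.2 (not_lt.1 h)) hm.le]
  rw [div_sub_div _ _ hC0.ne' hc.ne', abs_div, abs_of_pos (mul_pos hC0 hc),
    div_lt_iff₀ (mul_pos hC0 hc)]
  have e : T * c - C * t = c * (T - n * t) - t * (C - n * c) := by ring
  have hlt : |T * c - C * t| < 2 * (c * (η * n)) := by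
    rw [e, abs_lt]
    have a1 := mul_lt_mul_of_pos_left hT.1 hc
    have a2 := mul_lt_mul_of_pos_left hT.2 hc
    have a3 := mul_le_mul_of_nonneg_left hC.1.le ht
    have a4 := mul_le_mul_of_nonneg_left hC.2.le ht
    have a5 := mul_le_mul_of_nonneg_right htc (mul_pos hη0 hn).le
    constructor <;> linarith
  refine hlt.trans_le ?_
  have b1 : 4 * η ≤ δ * c := hηδ.trans (mul_le_mul_of_nonneg_left hmc hδ.le)
  calc 2 * (c * (η * n)) = 4 * η * (n * c / 2) := by ring
    _ ≤ δ * c * (n * c / 2) := by gcongr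
    _ ≤ δ * c * C := by gcongr
    _ = δ * (C * c) := by ring

end Concentration

/-! ### Bounds and continuity of the limiting ratio -/

section LimitTransitivity

variable {s : ℕ} {p ρ ε M : ℝ}

/-- The first term suffices, as `(s - 1) * (s - 2) ≥ 2` for `s ≥ 3`. -/
theorem le_limitTransitivity_denom (hs : 3 ≤ s) (hε : 0 < ε) (hp : ε ≤ p) (hρ : 0 ≤ ρ) :
    2 * ε ^ 2 ≤ ((s : ℝ) - 1) * ((s : ℝ) - 2) * p ^ 2 + 2 * ((s : ℝ) - 1) * p * ρ + ρ ^ 2 := by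
  have hs' : (3 : ℝ) ≤ s := by exact_mod_cast hs
  have h1 : (2 : ℝ) ≤ ((s : ℝ) - 1) * ((s : ℝ) - 2) := by nlinarith
  have h2 : ε ^ 2 ≤ p ^ 2 := pow_le_pow_left₀ hε.le hp 2
  have h3 : 0 ≤ 2 * ((s : ℝ) - 1) * p * ρ := by
    have : 0 ≤ p * ρ := mul_nonneg (hε.le.trans hp) hρ
    nlinarith
  nlinarith [sq_nonneg ρ, mul_le_mul h1 h2 (sq_nonneg ε) (by linarith)]

theorem limitTransitivity_pos (hs : 3 ≤ s) (hp : 0 < p) (hρ : 0 ≤ ρ) :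
    0 < limitTransitivity s p ρ := by
  have hs' : (3 : ℝ) ≤ s := by exact_mod_cast hs
  have h := le_limitTransitivity_denom hs hp le_rfl hρ
  have h1 : 0 < (s : ℝ) - 1 := by linarith
  have h2 : 0 < (s : ℝ) - 2 := by linarith
  exact div_pos (by positivity) (lt_of_lt_of_le (by positivity) h)

theorem exists_pos_le_limitTransitivity (hs : 3 ≤ s) (hε : 0 < ε) (hM : 0 ≤ M) :
    ∃ c₀ : ℝ, 0 < c₀ ∧ ∀ p ρ : ℝ, ε ≤ p → p ≤ 1 → 0 ≤ ρ → ρ ≤ M →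
      c₀ ≤ limitTransitivity s p ρ := by
  have hs' : (3 : ℝ) ≤ s := by exact_mod_cast hs
  have h1 : (0 : ℝ) ≤ (s : ℝ) - 1 := by linarith
  have h2 : (0 : ℝ) ≤ (s : ℝ) - 2 := by linarith
  have h3 : (2 : ℝ) ≤ ((s : ℝ) - 1) * ((s : ℝ) - 2) := by nlinarith
  -- The denominator increases in `p` and `ρ`, so it is largest at `p = 1`, `ρ = M`; the numerator
  -- is at least `2 * ε ^ 3`.
  refine ⟨2 * ε ^ 3 / (((s : ℝ) - 1) * ((s : ℝ) - 2) * 1 ^ 2 + 2 * ((s : ℝ) - 1) * 1 * M + M ^ 2),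
    by positivity, fun p ρ hp hp1 hρ hρM => ?_⟩
  have hp0 : 0 < p := hε.trans_le hp
  have h := le_limitTransitivity_denom hs hε hp hρ
  have hpos : 0 < 2 * ε ^ 2 := by positivity
  unfold limitTransitivity
  refine div_le_div₀ (by positivity) ?_ (hpos.trans_le h) (by gcongr)
  exact mul_le_mul h3 (pow_le_pow_left₀ hε.le hp 3) (by positivity) (by linarith)

theorem tendsto_limitTransitivity (hs : 3 ≤ s) (hp : 0 < p) (hρ : 0 ≤ ρ) {u v : ℕ → ℝ}
    (hu : Tendsto u atTop (𝓝 p)) (hv : Tendsto v atTop (𝓝 ρ)) :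
    Tendsto (fun K => limitTransitivity s (u K) (v K)) atTop (𝓝 (limitTransitivity s p ρ)) := by
  have h := le_limitTransitivity_denom hs hp le_rfl hρ
  have hpos : 0 < 2 * p ^ 2 := by positivity
  exact ((hu.pow 3).const_mul _).div
    ((((hu.pow 2).const_mul _).add ((hu.const_mul _).mul hv)).add (hv.pow 2)) (hpos.trans_le h).ne'

end LimitTransitivity

/-! ### Convergence in probability -/

/-- A quantitative form of the convergence of the transitivity ratio. -/
theorem exists_measureReal_transitivityRatio_le (s : ℕ) (hs : 3 ≤ s) {ε M δ : ℝ} (hε : 0 < ε)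
    (hM : 0 ≤ M) (hδ : 0 < δ) :
    ∃ D : ℝ, ∀ {Ω : Type*} [MeasurableSpace Ω] (P : Measure Ω) [IsProbabilityMeasure P] (K : ℕ)
      (p r : ℝ) (ξ : Ω → Fin (K * s) → Fin K) (A : Ω → SimpleGraph (Fin (K * s))), 1 ≤ K →
      ε ≤ p → ((K * s : ℕ) : ℝ) * r ≤ M → IsFourParameterSBM P K s p r ξ A →
      P.real {ω | δ ≤ |transitivityRatio (A ω) -
        limitTransitivity s p (((K * s : ℕ) : ℝ) * r)|} ≤ D / ((K * s : ℕ) : ℝ) := by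
  classical
  obtain ⟨D, hD, h⟩ := exists_second_moment_le s (by omega) M hM
  set m : ℝ := 2 * ε ^ 2
  have hm : 0 < m := by positivity
  -- The largest tolerance allowed by both smallness conditions of `abs_div_sub_div_lt`.
  set η : ℝ := min (m / 2) (δ * m / 4)
  have hη : 0 < η := lt_min (by positivity) (by positivity)
  refine ⟨D / η ^ 2, fun {Ω} _ P _ K p r ξ A hK hp hr hA => ?_⟩
  have hn : 1 ≤ K * s := Nat.mul_pos hK (by omega)
  generalize hN : ((K * s : ℕ) : ℝ) = N at *
  have hN0 : 0 < N := by
    rw [← hN]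
    exact_mod_cast hn
  refine hA.measureReal_le (fun G => δ ≤ |transitivityRatio G - limitTransitivity s p (N * r)|)
    (by positivity) fun z hz => ?_
  have hb := h (K * s) K p r z hn hA.p_mem hA.r_mem (by rwa [hN]) hz
  have hs' : (3 : ℝ) ≤ s := by exact_mod_cast hs
  have hp0 : 0 < p := hε.trans_le hp
  have hNr : 0 ≤ N * r := mul_nonneg hN0.le hA.r_mem.1
  have hmc := le_limitTransitivity_denom hs hε hp hNr
  rw [hN] at hb
  set t : ℝ := ((s : ℝ) - 1) * ((s : ℝ) - 2) * p ^ 3 with ht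
  set c : ℝ := ((s : ℝ) - 1) * ((s : ℝ) - 2) * p ^ 2 + 2 * ((s : ℝ) - 1) * p * (N * r) +
    (N * r) ^ 2 with hc
  have h1 : (0 : ℝ) ≤ (s : ℝ) - 1 := by linarith
  have h2 : (0 : ℝ) ≤ (s : ℝ) - 2 := by linarith
  have ht0 : 0 ≤ t := by positivity
  have htc : t ≤ c := by
    have e1 : ((s : ℝ) - 1) * ((s : ℝ) - 2) * p ^ 3 ≤ ((s : ℝ) - 1) * ((s : ℝ) - 2) * p ^ 2 :=
      mul_le_mul_of_nonneg_left (pow_le_pow_of_le_one hp0.le hA.p_mem.2 (by norm_num))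
        (by positivity)
    have e2 : 0 ≤ 2 * ((s : ℝ) - 1) * p * (N * r) := by positivity
    linarith [sq_nonneg (N * r)]
  have hη1 : 2 * η ≤ m := by linarith [min_le_left (m / 2) (δ * m / 4)]
  have hη2 : 4 * η ≤ δ * m := by linarith [min_le_right (m / 2) (δ * m / 4)]
  calc graphExpect (blockProb p r z) (fun G =>
        if δ ≤ |transitivityRatio G - limitTransitivity s p (N * r)| then 1 else 0)
      ≤ graphExpect (blockProb p r z) (fun G => (1 / (η * N) ^ 2) *
          (((closedTriplets G : ℝ) - N * t) ^ 2 + ((connectedTriples G : ℝ) - N * c) ^ 2)) := by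
        refine graphExpect_mono (blockProb_mem hA.p_mem hA.r_mem) fun G => ?_
        split_ifs with hG
        · rw [one_div, ← div_eq_inv_mul, one_le_div (by positivity)]
          -- Chebyshev: if the squared deviations summed to less than `(η * N) ^ 2`, both counts
          -- would be near their targets and the ratio would be within `δ`.
          by_contra hlt
          rw [not_le] at hlt
          have hpos : 0 ≤ η * N := by positivity
          refine absurd hG (not_le.2 (abs_div_sub_div_lt hN0 ht0 htc hm hmc hη1 hη2 ?_ ?_))
          · exact abs_lt_of_sq_lt_sq (by linarith [sq_nonneg ((connectedTriples G : ℝ) - N * c)])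
              hpos
          · exact abs_lt_of_sq_lt_sq (by linarith [sq_nonneg ((closedTriplets G : ℝ) - N * t)])
              hpos
        · positivity
    _ ≤ 1 / (η * N) ^ 2 * (D * N) := by
        rw [graphExpect_const_mul]
        exact mul_le_mul_of_nonneg_left hb (by positivity)
    _ = D / η ^ 2 / N := by field_simp

/-- The `O` bound holds only from some `K₀` on; before that, `r K ≤ 1` gives `K * s * r K ≤ K₀ * s`.
A bound for every `K` is what the uniform lower bound requires. -/
theorem exists_bound_of_isBigO_inv (s : ℕ) {r : ℕ → ℝ}
    (h1 : ∀ K, r K ≤ 1) (hr : r =O[atTop] fun K : ℕ => (((K * s : ℕ) : ℝ))⁻¹) :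
    ∃ M : ℝ, 0 ≤ M ∧ ∀ K, ((K * s : ℕ) : ℝ) * r K ≤ M := by
  obtain ⟨C, hC⟩ := hr.bound
  obtain ⟨K₀, hK₀⟩ := eventually_atTop.1 hC
  refine ⟨max (max C 0) ((K₀ * s : ℕ) : ℝ), by positivity, fun K => ?_⟩
  have hN : (0 : ℝ) ≤ ((K * s : ℕ) : ℝ) := Nat.cast_nonneg _
  rcases le_total K₀ K with hK | hK
  · refine le_max_of_le_left ?_
    have h := (le_abs_self _).trans (hK₀ K hK)
    rw [norm_inv, Real.norm_of_nonneg hN] at h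
    rcases hN.eq_or_lt with h0 | h0
    · rw [← h0, zero_mul]
      exact le_max_right _ _
    · refine le_max_of_le_left ?_
      calc _ ≤ ((K * s : ℕ) : ℝ) * (C * ((K * s : ℕ) : ℝ)⁻¹) := by gcongr
        _ = C := by field_simp
  · refine le_max_of_le_right ((mul_le_of_le_one_right hN (h1 K)).trans ?_)
    exact Nat.cast_le.2 (Nat.mul_le_mul_right s hK)

/-- Slutsky's lemma for convergence in probability to a constant. -/
theorem TendstoInProbability.of_sub {Ω : ℕ → Type*} [∀ K, MeasurableSpace (Ω K)]
    {P : ∀ K, Measure (Ω K)} {X : ∀ K, Ω K → ℝ} {a : ℕ → ℝ} {c : ℝ}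
    (h : TendstoInProbability P (fun K ω => X K ω - a K) 0) (ha : Tendsto a atTop (𝓝 c)) :
    TendstoInProbability P X c := by
  intro δ hδ
  refine tendsto_of_tendsto_of_tendsto_of_le_of_le' tendsto_const_nhds (h (δ / 2) (half_pos hδ))
    (Eventually.of_forall fun _ => zero_le) ?_
  filter_upwards [Metric.tendsto_nhds.1 ha (δ / 2) (half_pos hδ)] with K hK
  refine measure_mono fun ω hω => ?_
  rw [Set.mem_ofPred_eq] at hω ⊢
  rw [Real.dist_eq] at hK
  have := abs_sub_le (X K ω) (a K) c
  rw [sub_zero]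
  linarith

theorem mainTheorem3 {Ω : ℕ → Type*} [∀ K, MeasurableSpace (Ω K)]
    (P : ∀ K, Measure (Ω K)) [∀ K, IsProbabilityMeasure (P K)]
    (s : ℕ) (hs : 3 ≤ s) (ε : ℝ) (hε : 0 < ε) (p r : ℕ → ℝ)
    (hp : ∀ K, ε < p K)
    (hr : r =O[atTop] fun K : ℕ => (((K * s : ℕ) : ℝ))⁻¹)
    (ξ : ∀ K, Ω K → Fin (K * s) → Fin K)
    (A : ∀ K, Ω K → SimpleGraph (Fin (K * s)))
    (hA : ∀ K, IsFourParameterSBM (P K) K s (p K) (r K) (ξ K) (A K)) :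
    (∃ c₀ : ℝ, 0 < c₀ ∧ ∀ K, c₀ ≤ limitTransitivity s (p K) (((K * s : ℕ) : ℝ) * r K)) ∧
    TendstoInProbability P
      (fun K ω => transitivityRatio (A K ω) -
        limitTransitivity s (p K) (((K * s : ℕ) : ℝ) * r K)) 0 ∧
    (∀ p' ρ : ℝ, Tendsto p atTop (𝓝 p') →
      Tendsto (fun K : ℕ => ((K * s : ℕ) : ℝ) * r K) atTop (𝓝 ρ) →
      0 < limitTransitivity s p' ρ ∧
      TendstoInProbability P (fun K ω => transitivityRatio (A K ω))
        (limitTransitivity s p' ρ)) := by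
  obtain ⟨M, hM0, hM⟩ := exists_bound_of_isBigO_inv s (fun K => (hA K).r_mem.2) hr
  have hρ0 : ∀ K, 0 ≤ ((K * s : ℕ) : ℝ) * r K := fun K =>
    mul_nonneg (Nat.cast_nonneg _) (hA K).r_mem.1
  have hconv : TendstoInProbability P (fun K ω => transitivityRatio (A K ω) -
      limitTransitivity s (p K) (((K * s : ℕ) : ℝ) * r K)) 0 := by
    intro δ hδ
    obtain ⟨D, hD⟩ := exists_measureReal_transitivityRatio_le s hs hε hM0 hδ
    have hlim : Tendsto (fun K : ℕ => ENNReal.ofReal (D / ((K * s : ℕ) : ℝ))) atTop (𝓝 0) := by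
      rw [← ENNReal.ofReal_zero]
      refine ENNReal.tendsto_ofReal (Tendsto.div_atTop tendsto_const_nhds
        (tendsto_natCast_atTop_atTop.comp (tendsto_id.atTop_mul_const' (by omega))))
    refine tendsto_of_tendsto_of_tendsto_of_le_of_le' tendsto_const_nhds hlim
      (Eventually.of_forall fun _ => zero_le) ?_
    filter_upwards [eventually_ge_atTop 1] with K hK
    rw [← ofReal_measureReal (measure_ne_top _ _)]
    refine ENNReal.ofReal_le_ofReal ?_
    simpa only [sub_zero] using hD (P K) K (p K) (r K) (ξ K) (A K) hK (hp K).le (hM K) (hA K)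
  refine ⟨?_, hconv, fun p' ρ hp' hρ => ?_⟩
  · obtain ⟨c₀, hc₀, h⟩ := exists_pos_le_limitTransitivity hs hε hM0
    exact ⟨c₀, hc₀, fun K => h _ _ (hp K).le (hA K).p_mem.2 (hρ0 K) (hM K)⟩
  -- The limit inherits `ε ≤ p'`, so it cannot degenerate to zero.
  · have hp0 : 0 < p' := hε.trans_le (ge_of_tendsto' hp' fun K => (hp K).le)
    have hρ' : 0 ≤ ρ := ge_of_tendsto' hρ hρ0
    exact ⟨limitTransitivity_pos hs hp0 hρ',
      hconv.of_sub (tendsto_limitTransitivity hs hp0 hρ' hp' hρ)⟩
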